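/- For a vector $u=(u_1,u_2)\in\mathbb{Z}^2$ write $X^{u}=x^{u_1}y^{u_2}$. For a finite set $D\subseteq\mathbb{Z}^2$ let $f_D=\sum_{u\in D}X^{-u}\in\mathbb{C}[x^{\pm1},y^{\pm1}]$. A line polynomial is a Laurent polynomial $\varphi\in\mathbb{C}[x^{\pm1},y^{\pm1}]$ whose support (the set of exponent vectors with non-zero coefficient) contains at least two points and lies on a single line; a Laurent polynomial $f$ has no line polynomial factors if no line polynomial divides $f$ in $\mathbb{C}[x^{\pm1},y^{\pm1}]$. Let $\mathcal{A}=\{a_1,\dots,a_n\}$ be a finite alphabet. A configuration $c\in\mathcal{A}^{\mathbb{Z}^2}$ is a $D$-perfect coloring with matrix $\mathbf{B}=(b_{ij})_{n\times n}\in\mathbb{Z}^{n\times n}$ if for all $i,j$ and all $u\in\mathbb{Z}^2$ with $c_u=a_j$, exactly $b_{ij}$ elements $d\in D$ satisfy $c_{u+d}=a_i$; it is a $D$-perfect coloring if this holds for some $\mathbf{B}$. A configuration $c$ is two-periodic if there are two linearly independent vectors $s,t\in\mathbb{Z}^2$ with $c_{u-s}=c_u=c_{u-t}$ for all $u\in\mathbb{Z}^2$.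 Theorem. Let $D\subseteq\mathbb{Z}^2$ be finite. (i) Suppose there is an integer $t_0$ such that $f_D-t$ has no line polynomial factors for every complex number $t\neq t_0$. Then every $D$-perfect coloring with matrix $\mathbf{B}$ is two-periodic whenever $\det(\mathbf{B}-t_0\mathbf{I})\neq0$. (ii) If $f_D-t$ has no line polynomial factors for any complex number $t$, then every $D$-perfect coloring is two-periodic. -/

import Mathlib

/-- Complex Laurent polynomials in two variables: finitely supported functions on the exponent
group `ℤ × ℤ`, multiplied by convolution. -/
abbrev Laurent2 : Type := AddMonoidAlgebra ℂ (ℤ × ℤ)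

/-- The monomial `X ^ u`. -/
noncomputable def Laurent2.X (u : ℤ × ℤ) : Laurent2 := AddMonoidAlgebra.single u 1

/-- The polynomial `f_D = ∑_{u ∈ D} X ^ (-u)`. -/
noncomputable def shapePoly (D : Finset (ℤ × ℤ)) : Laurent2 := ∑ u ∈ D, Laurent2.X (-u)

/-- A line polynomial: the support contains at least two points and lies on a line `u + ℚ v`. -/
def IsLinePolynomial (f : Laurent2) : Prop :=
  2 ≤ f.coeff.support.card ∧
    ∃ u v : ℤ × ℤ, ∀ w ∈ f.coeff.support, ∃ q : ℚ,
      (w.1 : ℚ) = u.1 + q * v.1 ∧ (w.2 : ℚ) = u.2 + q * v.2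

/-- `f` has no line polynomial factors. -/
def NoLinePolynomialFactors (f : Laurent2) : Prop :=
  ∀ φ : Laurent2, IsLinePolynomial φ → ¬ φ ∣ f

/-- The configuration `c` is a `D`-perfect coloring with matrix `B`: every cell `u` of color `j`
has exactly `B i j` cells of color `i` in its neighborhood `u + D`. -/
def IsPerfectColoringWith {A : Type*} [DecidableEq A] (D : Finset (ℤ × ℤ)) (B : Matrix A A ℤ)
    (c : ℤ × ℤ → A) : Prop :=
  ∀ i j : A, ∀ u : ℤ × ℤ, c u = j → ((D.filter fun d => c (u + d) = i).card : ℤ) = B i j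

/-- `c` is a `D`-perfect coloring. -/
def IsPerfectColoring {A : Type*} [DecidableEq A] (D : Finset (ℤ × ℤ)) (c : ℤ × ℤ → A) : Prop :=
  ∃ B : Matrix A A ℤ, IsPerfectColoringWith D B c

/-- `c` is two-periodic: it has two linearly independent vectors of periodicity
(`translate s c` is the translation `u ↦ c (u - s)`). -/
def IsTwoPeriodic {A : Type*} (c : ℤ × ℤ → A) : Prop :=
  ∃ s t : ℤ × ℤ, LinearIndependent ℤ ![s, t] ∧ translate s c = c ∧ translate t c = c

/-! Counting neighbors says that multiplication by `f_D` acts on the color indicators through `B`,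
so by Cayley–Hamilton `F = χ_B(f_D)` annihilates each of them; over `ℂ`, `F` is the product of the
`f_D - t` over the eigenvalues `t` of `B`, none of which has a line polynomial factor.

Since `F` has integer coefficients and indicators are bounded, the Frobenius congruence shows that
suitable dilations of `F` annihilate too, and a Vandermonde-type elimination yields an annihilator
`∏ (X ^ w - 1)` (`exists_special_annihilator`). Each `X ^ w - 1` is a product of line polynomials `X
^ w' - ζ`, none dividing `f_D - t`, so every monomial is algebraic modulo `f_D - t` and `X ^ w - 1`
(`exists_aeval_mem_of_noLinePolynomialFactors`).

Combining the factors, a nonzero one-variable polynomial in `X ^ u` annihilates all indicators. This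
is a linear recurrence along direction `u`, which forces a period over a finite alphabet
(`exists_period_of_aeval_mem`). -/

/-- The action of Laurent polynomials on configurations, in which `X ^ u` translates by `u`. -/
noncomputable def shiftAction (k : Type*) [CommRing k] :
    AddMonoidAlgebra k (ℤ × ℤ) →ₐ[k] Module.End k (ℤ × ℤ → k) :=
  AddMonoidAlgebra.lift k _ _
    { toFun := fun u => LinearMap.funLeft k k (fun w => w - u.toAdd)
      map_one' := by ext; simp [LinearMap.funLeft]
      map_mul' := fun u v => by
        apply LinearMap.ext; intro c; funext w
        simp [LinearMap.funLeft, sub_sub] }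

theorem shiftAction_single {k : Type*} [CommRing k] (u : ℤ × ℤ) (a : k) (c : ℤ × ℤ → k)
    (w : ℤ × ℤ) : shiftAction k (AddMonoidAlgebra.single u a) c w = a * c (w - u) := by
  simp [shiftAction, LinearMap.funLeft]

theorem shiftAction_sum_single {k ι : Type*} [CommRing k] (s : Finset ι) (v : ι → ℤ × ℤ)
    (a : ι → k) (c : ℤ × ℤ → k) (w : ℤ × ℤ) :
    shiftAction k (∑ i ∈ s, AddMonoidAlgebra.single (v i) (a i)) c w
      = ∑ i ∈ s, a i * c (w - v i) := by
  simp [map_sum, LinearMap.sum_apply, Finset.sum_apply, shiftAction_single]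

/-- The Laurent polynomials that annihilate the configuration `c`. -/
noncomputable def annihilatorIdeal {k : Type*} [CommRing k] (c : ℤ × ℤ → k) :
    Ideal (AddMonoidAlgebra k (ℤ × ℤ)) where
  carrier := {f | shiftAction k f c = 0}
  add_mem' := fun {f g} hf hg => by
    simp only [Set.mem_ofPred_eq] at *
    rw [map_add, LinearMap.add_apply, hf, hg, add_zero]
  zero_mem' := by simp
  smul_mem' := fun f g hg => by
    simp only [Set.mem_ofPred_eq] at *
    rw [smul_eq_mul, map_mul, Module.End.mul_apply, hg, map_zero]

theorem mem_annihilatorIdeal {k : Type*} [CommRing k] {c : ℤ × ℤ → k}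
    {f : AddMonoidAlgebra k (ℤ × ℤ)} : f ∈ annihilatorIdeal c ↔ shiftAction k f c = 0 :=
  Iff.rfl

/-! ### Frobenius congruence and dilations of annihilators -/

theorem Int.prime_dvd_pow_sub_self {p : ℕ} (hp : p.Prime) (a : ℤ) : (p : ℤ) ∣ a ^ p - a := by
  have := Fact.mk hp
  rw [← ZMod.intCast_zmod_eq_zero_iff_dvd]
  simp [ZMod.pow_card]

/-- The Frobenius congruence for Laurent polynomials with integer coefficients. -/
theorem prime_dvd_pow_sub_dilation {ι : Type*} {p : ℕ} (hp : p.Prime) (s : Finset ι)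
    (v : ι → ℤ × ℤ) (a : ι → ℤ) :
    (p : AddMonoidAlgebra ℤ (ℤ × ℤ)) ∣ (∑ i ∈ s, AddMonoidAlgebra.single (v i) (a i)) ^ p
      - ∑ i ∈ s, AddMonoidAlgebra.single (p • v i) (a i) := by
  classical
  induction s using Finset.induction_on with
  | empty => simp [hp.ne_zero]
  | insert i s hi ih =>
    rw [Finset.sum_insert hi, Finset.sum_insert hi]
    obtain ⟨r, hr⟩ := exists_add_pow_prime_eq hp (AddMonoidAlgebra.single (v i) (a i))
      (∑ i ∈ s, AddMonoidAlgebra.single (v i) (a i))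
    obtain ⟨t, ht⟩ := ih
    obtain ⟨m, hm⟩ := Int.prime_dvd_pow_sub_self hp (a i)
    rw [hr, AddMonoidAlgebra.single_pow]
    have h1 : AddMonoidAlgebra.single (p • v i) (a i ^ p) - AddMonoidAlgebra.single (p • v i) (a i)
        = (p : AddMonoidAlgebra ℤ (ℤ × ℤ)) * AddMonoidAlgebra.single (p • v i) m := by
      rw [← AddMonoidAlgebra.single_sub, hm, ← nsmul_eq_mul, ← nsmul_eq_mul,
        AddMonoidAlgebra.smul_single]
    refine ⟨AddMonoidAlgebra.single (p • v i) m + t + AddMonoidAlgebra.single (v i) (a i) *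
      (∑ i ∈ s, AddMonoidAlgebra.single (v i) (a i)) * r, ?_⟩
    linear_combination h1 + ht

/-- The `p`-th power annihilates `c` and is congruent modulo `p` to the dilation, so the dilated sum
is a multiple of `p`; being smaller than `p` in absolute value, it vanishes. -/
theorem dilation_annihilates_of_prime {ι : Type*} {p : ℕ} (hp : p.Prime) (s : Finset ι)
    (v : ι → ℤ × ℤ) (a : ι → ℤ) (hlt : ∑ i ∈ s, |a i| < p) {c : ℤ × ℤ → ℤ}
    (hc : ∀ w, |c w| ≤ 1) (h : ∀ w, ∑ i ∈ s, a i * c (w - v i) = 0) (w : ℤ × ℤ) :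
    ∑ i ∈ s, a i * c (w - p • v i) = 0 := by
  obtain ⟨t, ht⟩ := prime_dvd_pow_sub_dilation hp s v a
  have h0 : shiftAction ℤ (∑ i ∈ s, AddMonoidAlgebra.single (v i) (a i)) c = 0 := by
    funext w; rw [shiftAction_sum_single, h, Pi.zero_apply]
  have h1 : (∑ i ∈ s, AddMonoidAlgebra.single (v i) (a i)) ^ p ∈ annihilatorIdeal c :=
    Ideal.pow_mem_of_mem _ (mem_annihilatorIdeal.2 h0) _ hp.pos
  have h2 : ∑ i ∈ s, AddMonoidAlgebra.single (p • v i) (a i) =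
      (∑ i ∈ s, AddMonoidAlgebra.single (v i) (a i)) ^ p - p * t := by
    linear_combination -ht
  have h3 : ∑ i ∈ s, a i * c (w - p • v i) = -((p : ℤ) * shiftAction ℤ t c w) := by
    rw [← shiftAction_sum_single s (fun i => p • v i), h2, map_sub, LinearMap.sub_apply,
      mem_annihilatorIdeal.1 h1, map_mul, map_natCast, Module.End.mul_apply]
    simp
  refine Int.eq_zero_of_abs_lt_dvd (m := (p : ℤ)) (h3 ▸ (dvd_mul_right _ _).neg_right) ?_
  refine lt_of_le_of_lt ((Finset.abs_sum_le_sum_abs _ _).trans (Finset.sum_le_sum fun i _ => ?_)) hlt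
  rw [abs_mul]
  exact mul_le_of_le_one_right (abs_nonneg _) (hc _)

/-- Dilating leaves the coefficients unchanged, so the same bound serves for each prime factor of
`n` in turn. -/
theorem dilation_annihilates {ι : Type*} (s : Finset ι) (v : ι → ℤ × ℤ) (a : ι → ℤ)
    {c : ℤ × ℤ → ℤ} (hc : ∀ w, |c w| ≤ 1) (h : ∀ w, ∑ i ∈ s, a i * c (w - v i) = 0) (n : ℕ)
    (hn : ∀ p : ℕ, p.Prime → p ∣ n → ∑ i ∈ s, |a i| < p) (hn0 : n ≠ 0) (w : ℤ × ℤ) :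
    ∑ i ∈ s, a i * c (w - n • v i) = 0 := by
  induction n using induction_on_primes generalizing w with
  | zero => exact absurd rfl hn0
  | one => simpa using h w
  | prime_mul p m hp ih =>
    have := dilation_annihilates_of_prime hp s (fun i => m • v i) a (hn p hp (dvd_mul_right _ _)) hc
      (fun w => ih (fun q hq hqm => hn q hq (hqm.mul_left _)) (by rintro rfl; simp at hn0) w) w
    simpa [mul_smul] using this

theorem exists_step_dilation_annihilates {ι : Type*} (s : Finset ι) (v : ι → ℤ × ℤ) (a : ι → ℤ) :
    ∃ r : ℕ, r ≠ 0 ∧ ∀ c : ℤ × ℤ → ℤ, (∀ w, |c w| ≤ 1) →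
      (∀ w, ∑ i ∈ s, a i * c (w - v i) = 0) →
      ∀ (k : ℕ) (w : ℤ × ℤ), ∑ i ∈ s, a i * c (w - (1 + k * r) • v i) = 0 := by
  -- With `r` this factorial, `1 + k * r` has no prime factor up to `∑ |a i|`.
  refine ⟨(∑ i ∈ s, |a i|).toNat.factorial, Nat.factorial_ne_zero _, fun c hc h k w => ?_⟩
  refine dilation_annihilates s v a hc h _ (fun p hp hpn => ?_) (by omega) w
  by_contra hle
  have h1 : p ∣ (∑ i ∈ s, |a i|).toNat.factorial := Nat.dvd_factorial hp.pos (by omega)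
  have h2 : p ∣ 1 := (Nat.dvd_add_left (h1.mul_left k)).1 hpn
  exact hp.one_lt.ne' (Nat.dvd_one.1 h2)

/-! ### Annihilators that are products of differences -/

/-- If all the power sums `∑ i, x i ^ k * m i` lie in an ideal, then so does each `m i` multiplied
by the differences of `x i` with the other `x j`. -/
theorem Ideal.prod_sub_mul_mem {R ι : Type*} [CommRing R] [DecidableEq ι] (I : Ideal R)
    (s : Finset ι) (x m : ι → R) (h : ∀ k : ℕ, ∑ i ∈ s, x i ^ k * m i ∈ I) {i₀ : ι} (hi₀ : i₀ ∈ s) :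
    (∏ j ∈ s.erase i₀, (x i₀ - x j)) * m i₀ ∈ I := by
  have key : ∀ P : Polynomial R, ∑ i ∈ s, P.eval (x i) * m i ∈ I := by
    intro P
    induction P using Polynomial.induction_on' with
    | add P Q hP hQ =>
      simp only [Polynomial.eval_add, add_mul, Finset.sum_add_distrib]
      exact I.add_mem hP hQ
    | monomial n a =>
      simp only [Polynomial.eval_monomial, mul_assoc, ← Finset.mul_sum]
      exact I.mul_mem_left _ (h n)
  -- This polynomial vanishes at every `x j` except possibly `x i₀`, isolating one term.
  have := key (∏ j ∈ s.erase i₀, (Polynomial.X - Polynomial.C (x j)))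
  rw [Finset.sum_eq_single_of_mem i₀ hi₀] at this
  · simpa [Polynomial.eval_prod] using this
  · intro i hi hne
    rw [Polynomial.eval_prod, Finset.prod_eq_zero (Finset.mem_erase.2 ⟨hne, hi⟩), zero_mul]
    simp

theorem single_mul_mem_iff {I : Ideal Laurent2} (u : ℤ × ℤ) {a : ℂ} (ha : a ≠ 0) {f : Laurent2} :
    AddMonoidAlgebra.single u a * f ∈ I ↔ f ∈ I := by
  refine ⟨fun h => ?_, fun h => I.mul_mem_left _ h⟩
  have := I.mul_mem_left (AddMonoidAlgebra.single (-u) a⁻¹) h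
  rwa [← mul_assoc, AddMonoidAlgebra.single_mul_single, neg_add_cancel, inv_mul_cancel₀ ha,
    ← AddMonoidAlgebra.one_def, one_mul] at this

/-- A nonzero Laurent polynomial with integer coefficients yields a product of differences
`X ^ w - 1` that annihilates every configuration with values in `{-1, 0, 1}` that it annihilates. -/
theorem exists_special_annihilator (F : AddMonoidAlgebra ℤ (ℤ × ℤ)) (hF : F ≠ 0) :
    ∃ L : List (ℤ × ℤ), (∀ w ∈ L, w ≠ 0) ∧ ∀ c : ℤ × ℤ → ℤ, (∀ w, |c w| ≤ 1) →
      F ∈ annihilatorIdeal c →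
      (L.map fun w => Laurent2.X w - 1).prod ∈ annihilatorIdeal (fun w => (c w : ℂ)) := by
  classical
  obtain ⟨r, hr0, hr⟩ := exists_step_dilation_annihilates F.coeff.support id F.coeff
  obtain ⟨v₀, hv₀⟩ := Finsupp.support_nonempty_iff.2 (AddMonoidAlgebra.coeff_eq_zero.not.2 hF)
  refine ⟨(F.coeff.support.erase v₀).toList.map fun v => r • (v₀ - v), ?_, fun c hc hFc => ?_⟩
  · intro w hw
    obtain ⟨v, hv, rfl⟩ := List.mem_map.1 hw
    rw [Finset.mem_toList, Finset.mem_erase] at hv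
    exact smul_ne_zero hr0 (sub_ne_zero.2 hv.1.symm)
  · have hF' : ∀ w, ∑ i ∈ F.coeff.support, F.coeff i * c (w - id i) = 0 := by
      intro w
      rw [← shiftAction_sum_single]
      have : ∑ i ∈ F.coeff.support, AddMonoidAlgebra.single (id i) (F.coeff i) = F :=
        AddMonoidAlgebra.sum_coeff_single F
      rw [this, mem_annihilatorIdeal.1 hFc]; rfl
    -- Since `X ^ ((1 + k * r) • v) = (X ^ (r • v)) ^ k * X ^ v`, the dilations are power sums in
    -- the `X ^ (r • v)`.
    have h1 := Ideal.prod_sub_mul_mem (annihilatorIdeal (fun w => (c w : ℂ))) F.coeff.support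
      (fun v => Laurent2.X (r • v)) (fun v => AddMonoidAlgebra.single v (F.coeff v : ℂ)) ?_ hv₀
    · rw [mul_comm, single_mul_mem_iff v₀ (by simpa using hv₀)] at h1
      have h2 : ∏ v ∈ F.coeff.support.erase v₀, (Laurent2.X (r • v₀) - Laurent2.X (r • v)) =
          Laurent2.X (∑ v ∈ F.coeff.support.erase v₀, r • v) *
          (((F.coeff.support.erase v₀).toList.map fun v => r • (v₀ - v)).map
            fun w => Laurent2.X w - 1).prod := by
        rw [List.map_map, Finset.prod_map_toList]
        have h3 : Laurent2.X (∑ v ∈ F.coeff.support.erase v₀, r • v) =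
            ∏ v ∈ F.coeff.support.erase v₀, Laurent2.X (r • v) := by
          generalize F.coeff.support.erase v₀ = s
          induction s using Finset.induction_on with
          | empty => rfl
          | insert i s hi ih =>
            rw [Finset.sum_insert hi, Finset.prod_insert hi, ← ih]
            simp [Laurent2.X, AddMonoidAlgebra.single_mul_single]
        rw [h3, ← Finset.prod_mul_distrib]
        refine Finset.prod_congr rfl fun v _ => ?_
        simp [Laurent2.X, mul_sub, AddMonoidAlgebra.single_mul_single, smul_sub]
      rw [h2] at h1
      exact (single_mul_mem_iff _ one_ne_zero).1 h1
    · intro k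
      rw [mem_annihilatorIdeal]
      have h2 : ∑ v ∈ F.coeff.support, Laurent2.X (r • v) ^ k *
          AddMonoidAlgebra.single v (F.coeff v : ℂ) =
          ∑ v ∈ F.coeff.support, AddMonoidAlgebra.single ((1 + k * r) • v) (F.coeff v : ℂ) := by
        refine Finset.sum_congr rfl fun v _ => ?_
        simp [Laurent2.X, AddMonoidAlgebra.single_pow, AddMonoidAlgebra.single_mul_single, add_smul,
          mul_smul, add_comm]
      rw [h2]
      funext w
      rw [shiftAction_sum_single]
      have := congrArg (Int.cast : ℤ → ℂ) (hr c hc hF' k w)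
      push_cast at this
      exact this

/-! ### Algebraicity of monomials modulo two Laurent polynomials -/

theorem Laurent2.X_add (u v : ℤ × ℤ) : Laurent2.X (u + v) = Laurent2.X u * Laurent2.X v := by
  simp [Laurent2.X, AddMonoidAlgebra.single_mul_single]

theorem Laurent2.X_nsmul (n : ℕ) (u : ℤ × ℤ) : Laurent2.X (n • u) = Laurent2.X u ^ n := by
  simp [Laurent2.X, AddMonoidAlgebra.single_pow]

theorem Laurent2.X_neg_mul (u : ℤ × ℤ) : Laurent2.X (-u) * Laurent2.X u = 1 := by
  rw [← Laurent2.X_add, neg_add_cancel]; rfl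

theorem isLinePolynomial_X_sub (w : ℤ × ℤ) (hw : w ≠ 0) {ζ : ℂ} (hζ : ζ ≠ 0) :
    IsLinePolynomial (Laurent2.X w - algebraMap ℂ Laurent2 ζ) := by
  have hs : (Laurent2.X w - algebraMap ℂ Laurent2 ζ).coeff.support = {w, 0} := by
    ext u
    have : (algebraMap ℂ Laurent2 ζ) = AddMonoidAlgebra.single 0 ζ := by
      simp
    rw [this, Finsupp.mem_support_iff, Laurent2.X, AddMonoidAlgebra.coeff_sub,
      AddMonoidAlgebra.coeff_single, AddMonoidAlgebra.coeff_single, Finsupp.sub_apply,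
      Finsupp.single_apply, Finsupp.single_apply]
    by_cases h1 : w = u
    · subst h1; simp [hw.symm]
    · by_cases h2 : 0 = u
      · subst h2; simp [hw, hζ]
      · simp [h1, h2, Ne.symm h1, Ne.symm h2]
  refine ⟨by rw [hs, Finset.card_pair hw], 0, w, fun u hu => ?_⟩
  rw [hs, Finset.mem_insert, Finset.mem_singleton] at hu
  rcases hu with rfl | rfl
  · exact ⟨1, by simp⟩
  · exact ⟨0, by simp⟩

theorem X_sub_dvd_X_zsmul_sub (w : ℤ × ℤ) {ζ : ℂ} (hζ : ζ ≠ 0) (a : ℤ) :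
    Laurent2.X w - algebraMap ℂ Laurent2 ζ ∣
      Laurent2.X (a • w) - algebraMap ℂ Laurent2 (ζ ^ a) := by
  have hnat : ∀ n : ℕ, Laurent2.X w - algebraMap ℂ Laurent2 ζ ∣
      Laurent2.X (n • w) - algebraMap ℂ Laurent2 (ζ ^ n) := by
    intro n
    rw [Laurent2.X_nsmul, map_pow]
    exact sub_dvd_pow_sub_pow _ _ n
  obtain ⟨n, rfl | rfl⟩ := a.eq_nat_or_neg
  · simpa using hnat n
  -- `X ^ (-nw) - ζ ^ (-n) = -X ^ (-nw) * ζ ^ (-n) * (X ^ (nw) - ζ ^ n)`.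
  · refine ((hnat n).mul_left (-(Laurent2.X (-(n • w)) *
      algebraMap ℂ Laurent2 ((ζ ^ n)⁻¹)))).trans (dvd_of_eq ?_)
    have h1 := Laurent2.X_neg_mul (n • w)
    have h2 : algebraMap ℂ Laurent2 ((ζ ^ n)⁻¹) * algebraMap ℂ Laurent2 (ζ ^ n) = 1 := by
      rw [← map_mul, inv_mul_cancel₀ (pow_ne_zero _ hζ), map_one]
    rw [zpow_neg, zpow_natCast, neg_smul, natCast_zsmul]
    linear_combination -algebraMap ℂ Laurent2 ((ζ ^ n)⁻¹) * h1 + Laurent2.X (-(n • w)) * h2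

theorem eq_smul_add_smul_of_det_eq_one {w z : ℤ × ℤ} (hdet : w.1 * z.2 - w.2 * z.1 = 1)
    (u : ℤ × ℤ) : u = (u.1 * z.2 - u.2 * z.1) • w + (w.1 * u.2 - w.2 * u.1) • z := by
  ext
  · simp only [Prod.fst_add, Prod.smul_fst, smul_eq_mul]
    linear_combination -u.1 * hdet
  · simp only [Prod.snd_add, Prod.smul_snd, smul_eq_mul]
    linear_combination -u.2 * hdet

/-- Modulo `X ^ w - ζ`, every Laurent polynomial is, up to a monomial, a polynomial in `X ^ z`,
where `w, z` is a basis of the lattice. -/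
theorem exists_aeval_congr {w z : ℤ × ℤ} (hdet : w.1 * z.2 - w.2 * z.1 = 1) {ζ : ℂ} (hζ : ζ ≠ 0)
    (f : Laurent2) : ∃ (N : ℕ) (P : Polynomial ℂ), Laurent2.X w - algebraMap ℂ Laurent2 ζ ∣
      Laurent2.X (N • z) * f - Polynomial.aeval (Laurent2.X z) P := by
  induction f using AddMonoidAlgebra.induction_linear with
  | zero => exact ⟨0, 0, by simp⟩
  | add f g hf hg =>
    obtain ⟨N, P, hP⟩ := hf
    obtain ⟨M, Q, hQ⟩ := hg
    refine ⟨N + M, Polynomial.X ^ M * P + Polynomial.X ^ N * Q, ?_⟩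
    refine ((hP.mul_left (Laurent2.X (M • z))).add (hQ.mul_left (Laurent2.X (N • z)))).trans
      (dvd_of_eq ?_)
    rw [add_smul, Laurent2.X_add]
    simp only [map_add, map_mul, map_pow, Polynomial.aeval_X, Laurent2.X_nsmul]
    ring
  | single u r =>
    set a := u.1 * z.2 - u.2 * z.1
    set b := w.1 * u.2 - w.2 * u.1
    refine ⟨b.natAbs, Polynomial.C (r * ζ ^ a) * Polynomial.X ^ (b.natAbs + b).toNat, ?_⟩
    refine ((X_sub_dvd_X_zsmul_sub w hζ a).mul_left
      (algebraMap ℂ Laurent2 r * Laurent2.X ((b.natAbs + b).toNat • z))).trans (dvd_of_eq ?_)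
    have h1 : AddMonoidAlgebra.single u r = algebraMap ℂ Laurent2 r * Laurent2.X u := by
      simp [Laurent2.X, AddMonoidAlgebra.single_mul_single]
    have h2 : b.natAbs • z + u = (b.natAbs + b).toNat • z + a • w := by
      conv_lhs => rw [eq_smul_add_smul_of_det_eq_one hdet u]
      rw [← natCast_zsmul, ← natCast_zsmul, Int.toNat_of_nonneg (by omega), add_smul]
      abel
    have h3 : Laurent2.X (b.natAbs • z) * Laurent2.X u =
        Laurent2.X ((b.natAbs + b).toNat • z) * Laurent2.X (a • w) := by
      rw [← Laurent2.X_add, ← Laurent2.X_add, h2]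
    rw [h1]
    simp only [map_mul, map_pow, Polynomial.aeval_X, Polynomial.aeval_C, ← Laurent2.X_nsmul]
    linear_combination -algebraMap ℂ Laurent2 r * h3

theorem isAlgebraic_X_zsmul {J : Ideal Laurent2} {w : ℤ × ℤ}
    (hw : IsAlgebraic ℂ (Ideal.Quotient.mk J (Laurent2.X w))) (a : ℤ) :
    IsAlgebraic ℂ (Ideal.Quotient.mk J (Laurent2.X (a • w))) := by
  have hnat : ∀ n : ℕ, IsAlgebraic ℂ (Ideal.Quotient.mk J (Laurent2.X (n • w))) := by
    intro n
    rw [Laurent2.X_nsmul, map_pow]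
    exact hw.pow n
  obtain ⟨n, rfl | rfl⟩ := a.eq_nat_or_neg
  · simpa using hnat n
  · have h1 : Ideal.Quotient.mk J (Laurent2.X (-(n • w))) *
        Ideal.Quotient.mk J (Laurent2.X (n • w)) = 1 := by
      rw [← map_mul, Laurent2.X_neg_mul, map_one]
    let : Invertible (Ideal.Quotient.mk J (Laurent2.X (n • w))) :=
      ⟨_, h1, by rw [mul_comm]; exact h1⟩
    rw [neg_smul, natCast_zsmul]
    exact (hnat n).invOf

/-- If the prime element `X ^ w - ζ` does not divide `f`, then every monomial is algebraic modulo
`f` and `X ^ w - ζ`. -/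
theorem exists_aeval_mem_of_not_dvd {w z : ℤ × ℤ} (hdet : w.1 * z.2 - w.2 * z.1 = 1) {ζ : ℂ}
    (hζ : ζ ≠ 0) {f : Laurent2} (hf : ¬ Laurent2.X w - algebraMap ℂ Laurent2 ζ ∣ f) (u : ℤ × ℤ) :
    ∃ p : Polynomial ℂ, p ≠ 0 ∧ Polynomial.aeval (Laurent2.X u) p ∈
      Ideal.span {f, Laurent2.X w - algebraMap ℂ Laurent2 ζ} := by
  set J := Ideal.span {f, Laurent2.X w - algebraMap ℂ Laurent2 ζ} with hJ
  have hfJ : f ∈ J := Ideal.subset_span (by simp)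
  have hwJ : Laurent2.X w - algebraMap ℂ Laurent2 ζ ∈ J := Ideal.subset_span (by simp)
  have haeval : ∀ (u : ℤ × ℤ) (p : Polynomial ℂ),
      Polynomial.aeval (Ideal.Quotient.mk J (Laurent2.X u)) p =
        Ideal.Quotient.mk J (Polynomial.aeval (Laurent2.X u) p) := fun u p =>
    Polynomial.aeval_algHom_apply (Ideal.Quotient.mkₐ ℂ J) (Laurent2.X u) p
  have hw : IsAlgebraic ℂ (Ideal.Quotient.mk J (Laurent2.X w)) := by
    refine ⟨Polynomial.X - Polynomial.C ζ, Polynomial.X_sub_C_ne_zero ζ, ?_⟩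
    rw [haeval, Ideal.Quotient.eq_zero_iff_mem]
    simpa using hwJ
  have hz : IsAlgebraic ℂ (Ideal.Quotient.mk J (Laurent2.X z)) := by
    obtain ⟨N, P, hP⟩ := exists_aeval_congr hdet hζ f
    refine ⟨P, ?_, ?_⟩
    -- If `P = 0`, then `X ^ w - ζ` divides a unit monomial times `f`, hence `f` itself.
    · rintro rfl
      rw [map_zero, sub_zero] at hP
      refine hf ((hP.mul_left (Laurent2.X (-(N • z)))).trans (dvd_of_eq ?_))
      rw [← mul_assoc, Laurent2.X_neg_mul, one_mul]
    · rw [haeval, Ideal.Quotient.eq_zero_iff_mem]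
      have := J.sub_mem (J.mul_mem_left (Laurent2.X (N • z)) hfJ) (J.mem_of_dvd hP hwJ)
      rwa [sub_sub_cancel] at this
  have hu : IsAlgebraic ℂ (Ideal.Quotient.mk J (Laurent2.X u)) := by
    rw [eq_smul_add_smul_of_det_eq_one hdet u, Laurent2.X_add, map_mul]
    exact (isAlgebraic_X_zsmul hw _).mul (isAlgebraic_X_zsmul hz _)
  obtain ⟨p, hp, hpu⟩ := hu
  exact ⟨p, hp, by rwa [haeval, Ideal.Quotient.eq_zero_iff_mem] at hpu⟩

/-- An element of `(f, g)` times an element of `(f, h)` lies in `(f, g * h)`, so the one-variable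
polynomials can be multiplied. -/
theorem exists_aeval_mem_span_pair_prod (x f : Laurent2) (S : Multiset Laurent2)
    (h : ∀ g ∈ S, ∃ p : Polynomial ℂ, p ≠ 0 ∧ Polynomial.aeval x p ∈ Ideal.span {f, g}) :
    ∃ p : Polynomial ℂ, p ≠ 0 ∧ Polynomial.aeval x p ∈ Ideal.span {f, S.prod} := by
  induction S using Multiset.induction_on with
  | empty =>
    exact ⟨1, one_ne_zero, by rw [map_one]; exact Ideal.subset_span (by simp)⟩
  | cons g S ih =>
    obtain ⟨p, hp, hpm⟩ := h g (Multiset.mem_cons_self _ _)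
    obtain ⟨q, hq, hqm⟩ := ih fun g' hg' => h g' (Multiset.mem_cons_of_mem hg')
    refine ⟨p * q, mul_ne_zero hp hq, ?_⟩
    obtain ⟨a, b, hab⟩ := Ideal.mem_span_pair.1 hpm
    obtain ⟨a', b', hab'⟩ := Ideal.mem_span_pair.1 hqm
    rw [Ideal.mem_span_pair, map_mul, Multiset.prod_cons, ← hab, ← hab']
    exact ⟨a * (a' * f + b' * S.prod) + b * g * a', b * b', by ring⟩

/-- Divide `v` by the gcd of its coordinates and complete the primitive vector to a lattice basis by
Bézout. -/
theorem exists_det_eq_one {v : ℤ × ℤ} (hv : v ≠ 0) : ∃ (k : ℕ) (w z : ℤ × ℤ),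
    k ≠ 0 ∧ v = k • w ∧ w.1 * z.2 - w.2 * z.1 = 1 := by
  have hg : 0 < v.1.gcd v.2 := by
    rw [Int.gcd_pos_iff]
    by_contra! h
    exact hv (Prod.ext h.1 h.2)
  obtain ⟨m, n, hmn, h1, h2⟩ := Int.exists_gcd_one hg
  refine ⟨v.1.gcd v.2, (m, n), (-m.gcdB n, m.gcdA n), hg.ne', ?_, ?_⟩
  · refine Prod.ext ?_ ?_
    · rw [Prod.smul_fst, nsmul_eq_mul, mul_comm]; exact h1
    · rw [Prod.smul_snd, nsmul_eq_mul, mul_comm]; exact h2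
  · have := Int.gcd_eq_gcd_ab m n
    rw [hmn] at this
    push_cast at this
    linear_combination -this

theorem exists_aeval_mem_of_noLinePolynomialFactors {f : Laurent2}
    (hf : NoLinePolynomialFactors f) {v : ℤ × ℤ} (hv : v ≠ 0) (u : ℤ × ℤ) :
    ∃ p : Polynomial ℂ, p ≠ 0 ∧
      Polynomial.aeval (Laurent2.X u) p ∈ Ideal.span {f, Laurent2.X v - 1} := by
  obtain ⟨k, w, z, hk, rfl, hdet⟩ := exists_det_eq_one hv
  have hw : w ≠ 0 := by rintro rfl; simp at hv
  -- `X ^ (k • w) - 1` splits as `∏ (X ^ w - ζ)` over the `k`-th roots of unity.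
  have hprod := congrArg (Polynomial.aeval (Laurent2.X w))
    ((IsAlgClosed.splits (Polynomial.X ^ k - 1 : Polynomial ℂ)).eq_prod_roots_of_monic
      (Polynomial.monic_X_pow_sub_C 1 hk))
  rw [map_multiset_prod, Multiset.map_map] at hprod
  simp only [map_sub, map_pow, Polynomial.aeval_X, map_one, ← Laurent2.X_nsmul] at hprod
  rw [hprod]
  refine exists_aeval_mem_span_pair_prod _ _ _ fun g hg => ?_
  obtain ⟨ζ, hζ, rfl⟩ := Multiset.mem_map.1 hg
  have hζ0 : ζ ≠ 0 := by
    rintro rfl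
    have := Polynomial.isRoot_of_mem_roots hζ
    simp [hk] at this
  have := exists_aeval_mem_of_not_dvd hdet hζ0 (hf _ (isLinePolynomial_X_sub w hw hζ0)) u
  simpa using this

/-! ### From recurrences to periods -/

/-- A sequence in a finite alphabet in which each window of length `d` determines the next symbol
has, as a period, the factorial of the number of windows. -/
theorem apply_add_factorial_of_window {A : Type*} [Fintype A] {d : ℕ} {σ : ℤ → A}
    (h : ∀ m n : ℤ, (∀ i : Fin d, σ (m + i) = σ (n + i)) → σ (m + d) = σ (n + d)) (n : ℤ) :
    σ (n + (Fintype.card (Fin d → A)).factorial) = σ n := by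
  classical
  set N := Fintype.card (Fin d → A) with hN
  have hstep : ∀ m n : ℤ, (∀ i : Fin d, σ (m + i) = σ (n + i)) →
      ∀ k : ℕ, σ (m + k) = σ (n + k) := by
    intro m n hmn k
    induction k using Nat.strong_induction_on with
    | _ k ih =>
      by_cases hk : k < d
      · exact hmn ⟨k, hk⟩
      · have h1 := h (m + (k - d : ℕ)) (n + (k - d : ℕ)) fun i => by
          have := ih (k - d + i) (by have := i.2; omega)
          push_cast at this
          rwa [← add_assoc, ← add_assoc] at this
        rwa [add_assoc, add_assoc, ← Nat.cast_add, Nat.sub_add_cancel (not_lt.1 hk)] at h1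
  -- Pigeonhole on the `N + 1` windows starting at `n - N, …, n`: all start no later than `n`, so a
  -- coincidence gives a period valid from `n` on.
  obtain ⟨x, y, hxy, hw⟩ := Fintype.exists_ne_map_eq_of_card_lt
    (fun (j : Fin (N + 1)) (i : Fin d) => σ (n - N + j + i)) (by simp [hN])
  wlog hlt : x < y generalizing x y
  · exact this y x hxy.symm hw.symm (lt_of_le_of_ne (not_lt.1 hlt) hxy.symm)
  have hper : ∀ t : ℤ, n ≤ t → σ (t + ((y : ℕ) - (x : ℕ) : ℕ)) = σ t := by
    intro t ht
    have hx : (x : ℕ) < y := hlt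
    have h2 := x.2
    have := hstep _ _ (fun i => congrFun hw i) (t - (n - N + x)).toNat
    rw [Int.toNat_of_nonneg (by omega)] at this
    rw [show t + ((y : ℕ) - (x : ℕ) : ℕ) = n - N + (y : ℕ) + (t - (n - N + (x : ℕ))) by
      push_cast [Nat.cast_sub hx.le]; ring, ← this]
    congr 1; ring
  have hmul : ∀ k : ℕ, σ (n + (k * ((y : ℕ) - (x : ℕ)) : ℕ)) = σ n := by
    intro k
    induction k with
    | zero => simp
    | succ k ih =>
      rw [← ih, ← hper (n + (k * ((y : ℕ) - (x : ℕ)) : ℕ)) (by omega)]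
      congr 1; push_cast; ring
  have hx : (x : ℕ) < y := hlt
  -- The period found depends on `σ` and `n` but is at most `N`; the factorial makes it uniform.
  obtain ⟨q, hq⟩ : (y : ℕ) - (x : ℕ) ∣ N.factorial :=
    Nat.dvd_factorial (by omega) (by have := y.2; omega)
  rw [hq, mul_comm]
  exact hmul q

/-- The indicator of the cells of color `i`. -/
def colorIndicator (k : Type*) [CommRing k] {A : Type*} [DecidableEq A] (c : ℤ × ℤ → A) (i : A) :
    ℤ × ℤ → k := fun w => if c w = i then 1 else 0

theorem shiftAction_aeval_X (p : Polynomial ℂ) (u : ℤ × ℤ) (e : ℤ × ℤ → ℂ) (w : ℤ × ℤ) :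
    shiftAction ℂ (Polynomial.aeval (Laurent2.X u) p) e w =
      ∑ n ∈ Finset.range (p.natDegree + 1), p.coeff n * e (w - n • u) := by
  have h : Polynomial.aeval (Laurent2.X u) p = ∑ n ∈ Finset.range (p.natDegree + 1),
      AddMonoidAlgebra.single (n • u) (p.coeff n) := by
    rw [Polynomial.aeval_eq_sum_range]
    exact Finset.sum_congr rfl fun n _ => by simp [Laurent2.X, AddMonoidAlgebra.single_pow]
  rw [h, shiftAction_sum_single]

/-- A configuration whose color indicators are annihilated by a nonzero polynomial in `X ^ u` has a
period in the direction of `u`. -/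
theorem exists_period_of_aeval_mem {A : Type*} [Fintype A] [DecidableEq A] (c : ℤ × ℤ → A)
    (u : ℤ × ℤ) (p : Polynomial ℂ) (hp : p ≠ 0)
    (h : ∀ i, Polynomial.aeval (Laurent2.X u) p ∈ annihilatorIdeal (colorIndicator ℂ c i)) :
    ∃ N : ℕ, N ≠ 0 ∧ translate (N • u) c = c := by
  classical
  -- This number depends only on `A` and the degree of `p`, so it serves all lines in direction `u`
  -- at once.
  refine ⟨(Fintype.card (Fin p.natDegree → A)).factorial, Nat.factorial_ne_zero _, ?_⟩
  funext w
  rw [translate_apply]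
  have key := apply_add_factorial_of_window (d := p.natDegree) (σ := fun n : ℤ => c (w - n • u)) ?_ 0
  · simpa using key
  intro m n hmn
  have hind : ∀ i, colorIndicator ℂ c i (w - (m + p.natDegree) • u) =
      colorIndicator ℂ c i (w - (n + p.natDegree) • u) := by
    intro i
    have e : ∀ m : ℤ, ∑ k ∈ Finset.range (p.natDegree + 1),
        p.coeff k * colorIndicator ℂ c i (w - (m + k) • u) = 0 := by
      intro m
      have := congrFun (mem_annihilatorIdeal.1 (h i)) (w - m • u)
      rw [shiftAction_aeval_X] at this
      rw [← this.trans (Pi.zero_apply _)]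
      refine Finset.sum_congr rfl fun k _ => ?_
      rw [add_smul, sub_sub, natCast_zsmul]
    have em := e m
    have en := e n
    rw [Finset.sum_range_succ] at em en
    have hs : ∑ k ∈ Finset.range p.natDegree, p.coeff k * colorIndicator ℂ c i (w - (m + k) • u) =
        ∑ k ∈ Finset.range p.natDegree, p.coeff k * colorIndicator ℂ c i (w - (n + k) • u) := by
      refine Finset.sum_congr rfl fun k hk => ?_
      have := hmn ⟨k, Finset.mem_range.1 hk⟩
      simp only [colorIndicator]
      rw [show c (w - (m + k) • u) = c (w - (n + k) • u) from this]
    refine mul_left_cancel₀ (Polynomial.leadingCoeff_ne_zero.2 hp) ?_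
    rw [Polynomial.leadingCoeff]
    linear_combination em - en - hs
  have := hind (c (w - (m + p.natDegree) • u))
  simp only [colorIndicator, if_true] at this
  by_contra hne
  rw [if_neg (Ne.symm hne)] at this
  exact one_ne_zero this

/-! ### Cayley–Hamilton for perfect colorings -/

theorem aeval_apply_of_matrix {k V A : Type*} [CommRing k] [AddCommGroup V] [Module k V]
    [Fintype A] [DecidableEq A] (E : Module.End k V) (B : Matrix A A k) (e : A → V)
    (h : ∀ i, E (e i) = ∑ j, B i j • e j) (p : Polynomial k) (i : A) :
    Polynomial.aeval E p (e i) = ∑ j, (Polynomial.aeval B p) i j • e j := by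
  induction p using Polynomial.induction_on generalizing i with
  | C a =>
    simp [Matrix.algebraMap_matrix_apply, ite_smul]
  | add p q hp hq =>
    simp [hp, hq, add_smul, Finset.sum_add_distrib]
  | monomial n a ih =>
    have hE : Polynomial.aeval E (Polynomial.C a * Polynomial.X ^ (n + 1)) =
        Polynomial.aeval E (Polynomial.C a * Polynomial.X ^ n) * E := by
      rw [pow_succ, ← mul_assoc, map_mul, Polynomial.aeval_X]
    have hB : Polynomial.aeval B (Polynomial.C a * Polynomial.X ^ (n + 1)) =
        B * Polynomial.aeval B (Polynomial.C a * Polynomial.X ^ n) := by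
      rw [pow_succ', mul_left_comm, map_mul, Polynomial.aeval_X]
    rw [hE, hB, Module.End.mul_apply, h, map_sum]
    simp only [map_smul, ih, Matrix.mul_apply, Finset.sum_smul, Finset.smul_sum, smul_smul]
    exact Finset.sum_comm

/-- The polynomial `f_D` with integer coefficients. -/
noncomputable def intShapePoly (D : Finset (ℤ × ℤ)) : AddMonoidAlgebra ℤ (ℤ × ℤ) :=
  ∑ u ∈ D, AddMonoidAlgebra.single (-u) 1

theorem mapRingHom_intShapePoly (D : Finset (ℤ × ℤ)) :
    AddMonoidAlgebra.mapRingHom (ℤ × ℤ) (Int.castRingHom ℂ) (intShapePoly D) = shapePoly D := by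
  rw [intShapePoly, shapePoly, map_sum]
  simp [Laurent2.X]

/-- The exponents `-u` in `f_D` make the action at a cell sum over its neighborhood. -/
theorem shiftAction_intShapePoly {A : Type*} [Fintype A] [DecidableEq A] {D : Finset (ℤ × ℤ)}
    {B : Matrix A A ℤ} {c : ℤ × ℤ → A} (hc : IsPerfectColoringWith D B c) (i : A) :
    shiftAction ℤ (intShapePoly D) (colorIndicator ℤ c i) =
      ∑ j, B i j • colorIndicator ℤ c j := by
  funext u
  rw [intShapePoly, shiftAction_sum_single]
  simp [colorIndicator, ← hc i (c u) u rfl]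

/-- Stated over `ℤ` because the dilation argument needs an annihilator with integer coefficients. -/
theorem aeval_charpoly_mem_annihilatorIdeal {A : Type*} [Fintype A] [DecidableEq A]
    {D : Finset (ℤ × ℤ)} {B : Matrix A A ℤ} {c : ℤ × ℤ → A} (hc : IsPerfectColoringWith D B c)
    (i : A) : Polynomial.aeval (intShapePoly D) B.charpoly ∈
      annihilatorIdeal (colorIndicator ℤ c i) := by
  rw [mem_annihilatorIdeal, ← Polynomial.aeval_algHom_apply,
    aeval_apply_of_matrix _ B _ (shiftAction_intShapePoly hc), Matrix.aeval_self_charpoly]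
  simp

theorem mapRingHom_aeval_charpoly {A : Type*} [Fintype A] [DecidableEq A] (D : Finset (ℤ × ℤ))
    (B : Matrix A A ℤ) :
    AddMonoidAlgebra.mapRingHom (ℤ × ℤ) (Int.castRingHom ℂ)
      (Polynomial.aeval (intShapePoly D) B.charpoly) =
    (((B.map (Int.castRingHom ℂ)).charpoly.roots).map
      fun t => shapePoly D - algebraMap ℂ Laurent2 t).prod := by
  have h := congrArg (Polynomial.aeval (shapePoly D))
    ((IsAlgClosed.splits (B.map (Int.castRingHom ℂ)).charpoly).eq_prod_roots_of_monic
      (Matrix.charpoly_monic _))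
  rw [map_multiset_prod, Multiset.map_map] at h
  simp only [Function.comp_def, map_sub, Polynomial.aeval_X, Polynomial.aeval_C] at h
  rw [← h, Matrix.charpoly_map, Polynomial.aeval_def, Polynomial.aeval_def, Polynomial.hom_eval₂,
    mapRingHom_intShapePoly, Polynomial.eval₂_map]
  congr 1
  exact RingHom.ext_int _ _

theorem mapRingHom_mem_annihilatorIdeal {c : ℤ × ℤ → ℤ} {F : AddMonoidAlgebra ℤ (ℤ × ℤ)}
    (h : F ∈ annihilatorIdeal c) :
    AddMonoidAlgebra.mapRingHom (ℤ × ℤ) (Int.castRingHom ℂ) F ∈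
      annihilatorIdeal (fun w => (c w : ℂ)) := by
  have key : ∀ w, shiftAction ℂ (AddMonoidAlgebra.mapRingHom (ℤ × ℤ) (Int.castRingHom ℂ) F)
      (fun w => (c w : ℂ)) w = (shiftAction ℤ F c w : ℂ) := by
    intro w
    clear h
    induction F using AddMonoidAlgebra.induction_linear with
    | zero => simp
    | add F G hF hG => simp [hF, hG]
    | single u a => simp [shiftAction_single]
  rw [mem_annihilatorIdeal]
  funext w
  rw [key, mem_annihilatorIdeal.1 h]
  simp

/-! ### Two-periodicity -/

theorem NoLinePolynomialFactors.ne_zero {f : Laurent2} (hf : NoLinePolynomialFactors f) :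
    f ≠ 0 := by
  rintro rfl
  exact hf _ (isLinePolynomial_X_sub (1, 0) (by simp) one_ne_zero) (dvd_zero _)

theorem isTwoPeriodic_of_roots {A : Type*} [Fintype A] [DecidableEq A] {D : Finset (ℤ × ℤ)}
    {B : Matrix A A ℤ} {c : ℤ × ℤ → A} (hc : IsPerfectColoringWith D B c)
    (hD : ∀ t ∈ (B.map (Int.castRingHom ℂ)).charpoly.roots,
      NoLinePolynomialFactors (shapePoly D - algebraMap ℂ Laurent2 t)) : IsTwoPeriodic c := by
  set F := Polynomial.aeval (intShapePoly D) B.charpoly with hFdef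
  have hF : F ≠ 0 := by
    intro h0
    have h1 := mapRingHom_aeval_charpoly D B
    rw [← hFdef, h0, map_zero, eq_comm, Multiset.prod_eq_zero_iff] at h1
    obtain ⟨t, ht, h2⟩ := Multiset.mem_map.1 h1
    exact (hD t ht).ne_zero h2
  obtain ⟨L, hL0, hL⟩ := exists_special_annihilator F hF
  have hper : ∀ u : ℤ × ℤ, ∃ N : ℕ, N ≠ 0 ∧ translate (N • u) c = c := by
    intro u
    have h1 : ∃ p : Polynomial ℂ, p ≠ 0 ∧ Polynomial.aeval (Laurent2.X u) p ∈
        Ideal.span {(L.map fun w => Laurent2.X w - 1).prod,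
          AddMonoidAlgebra.mapRingHom (ℤ × ℤ) (Int.castRingHom ℂ) F} := by
      rw [mapRingHom_aeval_charpoly]
      refine exists_aeval_mem_span_pair_prod _ _ _ fun g hg => ?_
      obtain ⟨t, ht, rfl⟩ := Multiset.mem_map.1 hg
      -- For a fixed eigenvalue `t`, swap the generators to split the other product, over `L`.
      rw [Ideal.span_pair_comm, ← Multiset.prod_coe]
      refine exists_aeval_mem_span_pair_prod _ _ _ fun g hg => ?_
      obtain ⟨w, hw, rfl⟩ := List.mem_map.1 (Multiset.mem_coe.1 hg)
      exact exists_aeval_mem_of_noLinePolynomialFactors (hD t ht) (hL0 w hw) u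
    obtain ⟨p, hp, hpm⟩ := h1
    refine exists_period_of_aeval_mem c u p hp fun i => ?_
    have hcast : colorIndicator ℂ c i = fun w => (colorIndicator ℤ c i w : ℂ) := by
      funext w; simp [colorIndicator]
    have hFi := aeval_charpoly_mem_annihilatorIdeal hc i
    rw [hcast]
    refine (Ideal.span_le.2 ?_) hpm
    rintro g (rfl | rfl)
    · refine hL _ (fun w => ?_) hFi
      simp only [colorIndicator]
      split_ifs <;> simp
    · exact mapRingHom_mem_annihilatorIdeal hFi
  obtain ⟨M, hM, h1⟩ := hper (1, 0)
  obtain ⟨N, hN, h2⟩ := hper (0, 1)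
  refine ⟨_, _, ?_, h1, h2⟩
  rw [LinearIndependent.pair_iff]
  intro s t hst
  simp only [Prod.smul_mk, Prod.mk_add_mk, Prod.mk_eq_zero] at hst
  simpa [hM, hN] using hst

theorem theorem5 {A : Type*} [Fintype A] [DecidableEq A] (D : Finset (ℤ × ℤ)) :
    (∀ t₀ : ℤ,
      (∀ t : ℂ, t ≠ (t₀ : ℂ) → NoLinePolynomialFactors (shapePoly D - algebraMap ℂ Laurent2 t)) →
        ∀ (B : Matrix A A ℤ) (c : ℤ × ℤ → A), IsPerfectColoringWith D B c →
          (B - t₀ • (1 : Matrix A A ℤ)).det ≠ 0 → IsTwoPeriodic c) ∧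
    ((∀ t : ℂ, NoLinePolynomialFactors (shapePoly D - algebraMap ℂ Laurent2 t)) →
      ∀ c : ℤ × ℤ → A, IsPerfectColoring D c → IsTwoPeriodic c) := by
  refine ⟨fun t₀ ht B c hc hdet => isTwoPeriodic_of_roots hc fun t htr => ht t ?_,
    fun ht c ⟨B, hc⟩ => isTwoPeriodic_of_roots hc fun t _ => ht t⟩
  -- If `t₀` were an eigenvalue of `B`, then `det (B - t₀ I)` would vanish.
  rintro rfl
  have h1 := Polynomial.isRoot_of_mem_roots htr
  rw [Matrix.charpoly_map, Polynomial.IsRoot, Polynomial.eval_intCast_map] at h1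
  have h2 : B.charpoly.eval t₀ = 0 := by simpa using h1
  rw [Matrix.eval_charpoly, ← neg_sub, Matrix.det_neg] at h2
  refine hdet ?_
  have h3 := (mul_eq_zero.1 h2).resolve_left (pow_ne_zero _ (by norm_num))
  rwa [Matrix.scalar_apply, ← Matrix.smul_one_eq_diagonal] at h3
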